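/- A spacetime is a connected, Hausdorff, second countable smooth manifold $M$ (without boundary) with a smooth Lorentzian metric $g$ of signature $(-,+,\dots,+)$ and a time orientation, i.e. a smooth timelike vector field $T$. A tangent vector $v\in T_xM$ is timelike if $g_x(v,v)<0$, lightlike if $v\neq 0$ and $g_x(v,v)=0$, causal if it is timelike or lightlike, and future directed if $g_x(T_x,v)<0$. For $x,y\in M$ write $x\ll y$ (resp. $x\mathrel{\alpha}y$) if there is a piecewise smooth curve from $x$ to $y$, defined on a non-degenerate compact interval, all of whose velocity vectors are future directed timelike (resp. future directed causal). The spacetime is chronological if $x\not\ll x$ for all $x\in M$, and causally non-totally vicious (cNTV) if there is $x\in M$ such that $x\mathrel{\alpha}x$ does not hold. Theorem. (i) There is a chronological spacetime that is not cNTV: the flat cylinder $\mathbb{R}\times S^1$ obtained as the quotient of two-dimensional Minkowski space $(\mathbb{R}^2, -(dx^0)^2+(dx^1)^2)$, time-oriented by $\partial_{x^0}$, by the translations by integer multiples of the null vector $(\pi,\pi)$, with quotient map $(x^0,x^1)\mapsto (x^0-x^1, e^{i(x^0+x^1)})$, is such a spacetime, and through each of its points passes a closed future directed lightlike curve. (ii)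 There is a cNTV spacetime that is not chronological: Misner spacetime, that is $\mathbb{R}\times S^1$ with coordinates $(t,\psi)$, where $\psi$ has period $2\pi$, metric $2\,dt\,d\psi+t\,d\psi^2$ and time orientation $(1+\tfrac t2)\partial_t-\partial_\psi$, is such a spacetime. So neither of the properties cNTV and chronological implies the other. -/

import Mathlib

open Set Bundle Manifold
open scoped ContDiff

/-- A (smooth) spacetime structure on a connected, Hausdorff, second countable smooth manifold `M`
without boundary: a smooth metric tensor `g` of signature `(-,+,...,+)` together with a time
orientation, i.e. a smooth timelike vector field `T`. -/
structure Spacetime {E : Type*} [NormedAddCommGroup E] [NormedSpace ℝ E] [FiniteDimensional ℝ E]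
    {H : Type*} [TopologicalSpace H] (I : ModelWithCorners ℝ E H)
    (M : Type*) [TopologicalSpace M] [ChartedSpace H M] [IsManifold I ∞ M]
    [BoundarylessManifold I M] [T2Space M] [SecondCountableTopology M] [ConnectedSpace M] where
  /-- the metric tensor -/
  g (x : M) : TangentSpace I x →L[ℝ] TangentSpace I x →L[ℝ] ℝ
  symm (x : M) (v w : TangentSpace I x) : g x v w = g x w v
  /-- at each point the metric is `diag(-1, 1, ..., 1)` in a suitable basis -/
  signature (x : M) : ∃ (n : ℕ) (b : Module.Basis (Fin (n + 1)) ℝ (TangentSpace I x)),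
    ∀ i j, g x (b i) (b j) = if i = j then (if i = 0 then -1 else 1) else 0
  smooth_g : ContMDiff I (I.prod 𝓘(ℝ, E →L[ℝ] E →L[ℝ] ℝ)) ∞
    (fun x ↦ TotalSpace.mk' (E →L[ℝ] E →L[ℝ] ℝ)
      (E := fun x : M ↦ TangentSpace I x →L[ℝ] TangentSpace I x →L[ℝ] ℝ) x (g x))
  /-- the time orientation -/
  T (x : M) : TangentSpace I x
  smooth_T : ContMDiff I I.tangent ∞ (fun x ↦ (⟨x, T x⟩ : TangentBundle I M))
  timelike_T (x : M) : g x (T x) (T x) < 0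

namespace Spacetime

section General

variable {E : Type*} [NormedAddCommGroup E] [NormedSpace ℝ E] [FiniteDimensional ℝ E]
    {H : Type*} [TopologicalSpace H] {I : ModelWithCorners ℝ E H}
    {M : Type*} [TopologicalSpace M] [ChartedSpace H M] [IsManifold I ∞ M]
    [BoundarylessManifold I M] [T2Space M] [SecondCountableTopology M] [ConnectedSpace M]
    (S : Spacetime I M)

/-- Timelike tangent vectors. -/
def IsTimelike (x : M) (v : TangentSpace I x) : Prop := S.g x v v < 0

/-- Lightlike tangent vectors. -/
def IsLightlike (x : M) (v : TangentSpace I x) : Prop := v ≠ 0 ∧ S.g x v v = 0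

/-- Causal tangent vectors. -/
def IsCausal (x : M) (v : TangentSpace I x) : Prop := S.IsTimelike x v ∨ S.IsLightlike x v

/-- Future directed tangent vectors. -/
def IsFutureDirected (x : M) (v : TangentSpace I x) : Prop := S.g x (S.T x) v < 0

variable (I) in
/-- There is a piecewise smooth curve `γ : [τ 0, τ n] → M` (with `n ≥ 1` smooth pieces
`[τ i, τ (i + 1)]`, where `τ i < τ (i + 1)`) from `x` to `y`, all of whose velocity vectors satisfy
`P`. At the break points both one-sided velocities are meant. -/
def ExistsCurve (P : (z : M) → TangentSpace I z → Prop) (x y : M) : Prop :=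
  ∃ (γ : ℝ → M) (n : ℕ) (τ : ℕ → ℝ), 0 < n ∧ γ (τ 0) = x ∧ γ (τ n) = y ∧
    ∀ i < n, τ i < τ (i + 1) ∧
      ContMDiffOn 𝓘(ℝ, ℝ) I ∞ γ (Icc (τ i) (τ (i + 1))) ∧
      ∀ s ∈ Icc (τ i) (τ (i + 1)),
        P (γ s) (mfderivWithin 𝓘(ℝ, ℝ) I γ (Icc (τ i) (τ (i + 1))) s (1 : ℝ))

/-- The chronology relation `x ≪ y`: there is a future directed timelike curve from `x` to `y`. -/
def Chron (x y : M) : Prop :=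
  ExistsCurve I (fun z v ↦ S.IsTimelike z v ∧ S.IsFutureDirected z v) x y

/-- The after relation `x α y`: there is a future directed causal curve from `x` to `y`. -/
def After (x y : M) : Prop :=
  ExistsCurve I (fun z v ↦ S.IsCausal z v ∧ S.IsFutureDirected z v) x y

/-- There is a future directed lightlike (null) curve from `x` to `y`. -/
def LightlikeTo (x y : M) : Prop :=
  ExistsCurve I (fun z v ↦ S.IsLightlike z v ∧ S.IsFutureDirected z v) x y

/-- A spacetime is chronological if no point chronologically precedes itself. -/
def IsChronological : Prop := ∀ x : M, ¬ S.Chron x x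

/-- A spacetime is causally non-totally vicious if some point does not come after itself. -/
def IsCNTV : Prop := ∃ x : M, ¬ S.After x x

end General

/-- The model with corners of the two-dimensional manifold `ℝ × S¹`. -/
noncomputable abbrev cylModel : ModelWithCorners ℝ (ℝ × EuclideanSpace ℝ (Fin 1))
    (ModelProd ℝ (EuclideanSpace ℝ (Fin 1))) := 𝓘(ℝ, ℝ).prod (𝓡 1)

/-- The metric and time orientation of a spacetime on `ℝ × S¹` pull back along
`p : ℝ² → ℝ × S¹` to the given metric `g₀` and vector field `T₀` on `ℝ²`. If `p` is a surjective
local diffeomorphism, this determines the spacetime. -/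
def PullsBackTo (S : Spacetime cylModel (ℝ × Circle)) (p : ℝ × ℝ → ℝ × Circle)
    (g₀ : ℝ × ℝ → ℝ × ℝ → ℝ × ℝ → ℝ) (T₀ : ℝ × ℝ → ℝ × ℝ) : Prop :=
  ∀ q : ℝ × ℝ,
    (∀ v w : ℝ × ℝ, S.g (p q) (mfderiv 𝓘(ℝ, ℝ × ℝ) cylModel p q v)
      (mfderiv 𝓘(ℝ, ℝ × ℝ) cylModel p q w) = g₀ q v w) ∧
    S.T (p q) = mfderiv 𝓘(ℝ, ℝ × ℝ) cylModel p q (T₀ q)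

/-- `S` is the flat cylinder with closed null curves: the quotient of two-dimensional Minkowski
space, with coordinates `(x⁰, x¹)`, metric `-(dx⁰)² + (dx¹)²` and time orientation `∂₀`, by the
translations by integer multiples of the null vector `(π, π)`. -/
def IsFlatNullCylinder (S : Spacetime cylModel (ℝ × Circle)) : Prop :=
  S.PullsBackTo (fun x ↦ (x.1 - x.2, Circle.exp (x.1 + x.2)))
    (fun _ v w ↦ -(v.1 * w.1) + v.2 * w.2) (fun _ ↦ (1, 0))

/-- `S` is Misner spacetime: in the coordinates `(t, ψ)`, with `ψ` an angle of period `2π`, the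
metric is `2 dt dψ + t dψ²` and the time orientation is given by `(1 + t / 2) ∂_t - ∂_ψ`. -/
def IsMisner (S : Spacetime cylModel (ℝ × Circle)) : Prop :=
  S.PullsBackTo (fun q ↦ (q.1, Circle.exp q.2))
    (fun q v w ↦ v.1 * w.2 + v.2 * w.1 + q.1 * (v.2 * w.2))
    (fun q ↦ (1 + q.1 / 2, -1))

end Spacetime

namespace Spacetime

/-- The covering of the cylinder by the plane with coordinates `(t, ψ)`. -/
noncomputable def cover (q : ℝ × ℝ) : ℝ × Circle := (q.1, Circle.exp q.2)

/-- The embedding of the cylinder into `ℝ × ℂ`. -/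
noncomputable def emb (x : ℝ × Circle) : ℝ × ℂ := (x.1, x.2)

/-- The action of the plane on the cylinder by translations and rotations. -/
noncomputable def shift (x : ℝ × Circle) (w : ℝ × ℝ) : ℝ × Circle :=
  (x.1 + w.1, x.2 * Circle.exp w.2)

theorem contMDiff_circle_coe : ContMDiff (𝓡 1) 𝓘(ℝ, ℂ) ∞ (fun z : Circle ↦ (z : ℂ)) :=
  haveI : Fact (Module.finrank ℝ ℂ = 1 + 1) := Complex.finrank_real_complex_fact
  contMDiff_coe_sphere (E := ℂ)

theorem contMDiff_emb : ContMDiff cylModel 𝓘(ℝ, ℝ × ℂ) ∞ emb :=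
  contMDiff_fst.prodMk_space (contMDiff_circle_coe.comp contMDiff_snd)

theorem contMDiff_cover : ContMDiff 𝓘(ℝ, ℝ × ℝ) cylModel ∞ cover :=
  contDiff_fst.contMDiff.prodMk (contMDiff_circleExp.comp contDiff_snd.contMDiff)

theorem contMDiff_shift :
    ContMDiff (cylModel.prod 𝓘(ℝ, ℝ × ℝ)) cylModel ∞ (Function.uncurry shift) := by
  have h1 : ContMDiff (cylModel.prod 𝓘(ℝ, ℝ × ℝ)) 𝓘(ℝ, ℝ) ∞
      (fun y : (ℝ × Circle) × (ℝ × ℝ) ↦ y.1.1 + y.2.1) :=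
    (contMDiff_fst.comp contMDiff_fst).add (contDiff_fst.contMDiff.comp contMDiff_snd)
  have h2 : ContMDiff (cylModel.prod 𝓘(ℝ, ℝ × ℝ)) (𝓡 1) ∞
      (fun y : (ℝ × Circle) × (ℝ × ℝ) ↦ y.1.2 * Circle.exp y.2.2) :=
    (contMDiff_snd.comp contMDiff_fst).mul
      (contMDiff_circleExp.comp (contDiff_snd.contMDiff.comp contMDiff_snd))
  exact h1.prodMk h2

/-- On the image of the derivative of `emb` at `x`, the coordinates `(dt, dψ)`. -/
noncomputable def embCoord (x : ℝ × Circle) : ℝ × ℂ →L[ℝ] ℝ × ℝ :=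
  (ContinuousLinearMap.inl ℝ ℝ ℝ).comp (ContinuousLinearMap.fst ℝ ℝ ℂ) +
    ((ContinuousLinearMap.inr ℝ ℝ ℝ).comp Complex.imCLM).comp
      ((ContinuousLinearMap.mul ℝ ℂ (star (x.2 : ℂ))).comp (ContinuousLinearMap.snd ℝ ℝ ℂ))

theorem embCoord_apply (x : ℝ × Circle) (v : ℝ × ℂ) :
    embCoord x v = (v.1, (star (x.2 : ℂ) * v.2).im) := by
  ext <;> simp [embCoord]

theorem contMDiff_embCoord : ContMDiff cylModel 𝓘(ℝ, ℝ × ℂ →L[ℝ] ℝ × ℝ) ∞ embCoord := by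
  have h : ContDiff ℝ ∞ (fun z : ℂ ↦
      (ContinuousLinearMap.inl ℝ ℝ ℝ).comp (ContinuousLinearMap.fst ℝ ℝ ℂ) +
      ((ContinuousLinearMap.inr ℝ ℝ ℝ).comp Complex.imCLM).comp
        ((ContinuousLinearMap.mul ℝ ℂ (star z)).comp (ContinuousLinearMap.snd ℝ ℝ ℂ))) :=
    contDiff_const.add (contDiff_const.clm_comp
      (((ContinuousLinearMap.mul ℝ ℂ).contDiff.comp Complex.conjCLE.contDiff).clm_comp
        contDiff_const))
  exact h.contMDiff.comp (contMDiff_circle_coe.comp contMDiff_snd)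

/-- The coframe `(dt, dψ)` of the cylinder. -/
noncomputable def coframe (x : ℝ × Circle) : TangentSpace cylModel x →L[ℝ] ℝ × ℝ :=
  (embCoord x).comp (mfderiv cylModel 𝓘(ℝ, ℝ × ℂ) emb x)

theorem contMDiffAt_coframe (x₀ : ℝ × Circle) :
    ContMDiffAt cylModel 𝓘(ℝ, (ℝ × EuclideanSpace ℝ (Fin 1)) →L[ℝ] ℝ × ℝ) ∞
      (fun x ↦ (coframe x).comp ((trivializationAt (ℝ × EuclideanSpace ℝ (Fin 1))
        (TangentSpace cylModel) x₀).symmL ℝ x)) x₀ := by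
  have h := (contMDiff_emb.contMDiffAt (x := x₀)).mfderiv_const (m := ∞) le_rfl
  refine (contMDiff_embCoord.contMDiffAt.clm_comp h).congr_of_eventuallyEq (.of_forall fun x ↦ ?_)
  simp only [inTangentCoordinates, ContinuousLinearMap.inCoordinates,
    TangentBundle.continuousLinearMapAt_model_space]
  rfl

theorem emb_cover (q : ℝ × ℝ) : emb (cover q) = (q.1, Complex.exp (q.2 * Complex.I)) := by
  simp [emb, cover, Circle.coe_exp]

theorem coframe_mfderiv_cover (q w : ℝ × ℝ) :
    coframe (cover q) (mfderiv 𝓘(ℝ, ℝ × ℝ) cylModel cover q w) = w := by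
  have h1 : mfderiv 𝓘(ℝ, ℝ × ℝ) 𝓘(ℝ, ℝ × ℂ) (emb ∘ cover) q =
      (mfderiv cylModel 𝓘(ℝ, ℝ × ℂ) emb (cover q)).comp
        (mfderiv 𝓘(ℝ, ℝ × ℝ) cylModel cover q) :=
    mfderiv_comp q (contMDiff_emb.mdifferentiableAt (by simp))
      (contMDiff_cover.mdifferentiableAt (by simp))
  have h2 : HasFDerivAt (emb ∘ cover)
      ((ContinuousLinearMap.fst ℝ ℝ ℝ).prod (((Complex.exp (q.2 * Complex.I)) •
        ((ContinuousLinearMap.toSpanSingleton ℝ Complex.I).comp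
          (ContinuousLinearMap.snd ℝ ℝ ℝ))))) q := by
    have : emb ∘ cover = fun q : ℝ × ℝ ↦ (q.1, Complex.exp (q.2 * Complex.I)) := funext emb_cover
    rw [this]
    refine hasFDerivAt_fst.prodMk (HasFDerivAt.cexp ?_)
    have := ((ContinuousLinearMap.toSpanSingleton ℝ Complex.I).comp
          (ContinuousLinearMap.snd ℝ ℝ ℝ)).hasFDerivAt (x := q)
    exact this.congr_of_eventuallyEq (.of_forall fun x ↦ by simp)
  have h3 := congrArg (fun f : (ℝ × ℝ) →L[ℝ] (ℝ × ℂ) ↦ embCoord (cover q) (f w))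
    (h1.symm.trans (mfderiv_eq_fderiv.trans h2.fderiv))
  refine h3.trans ?_
  have h4 : star (((cover q).2 : Circle) : ℂ) * Complex.exp (q.2 * Complex.I) = 1 := by
    have : Complex.exp (q.2 * Complex.I) = ((cover q).2 : ℂ) := by simp [cover, Circle.coe_exp]
    rw [this, ← starRingEnd_apply, ← Complex.normSq_eq_conj_mul_self]
    simp
  simp only [embCoord_apply]
  refine Prod.ext rfl ?_
  change (star _ * (Complex.exp (q.2 * Complex.I) * (w.2 • Complex.I))).im = w.2
  rw [← mul_assoc, h4]
  simp

theorem cover_surjective : Function.Surjective cover := fun x ↦ by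
  exact ⟨(x.1, Complex.arg x.2), Prod.ext rfl (Circle.exp_arg x.2)⟩

theorem shift_zero (x : ℝ × Circle) : shift x 0 = x := by simp [shift]

theorem shift_cover (q w : ℝ × ℝ) : shift (cover q) w = cover (q + w) := by
  simp [shift, cover, Circle.exp_add]

/-- The vector field on the cylinder with components `w` in the frame `(∂_t, ∂_ψ)`. -/
noncomputable def frame (x : ℝ × Circle) (w : ℝ × ℝ) : TangentSpace cylModel x :=
  mfderiv 𝓘(ℝ, ℝ × ℝ) cylModel (shift x) 0 w

theorem frame_cover (q w : ℝ × ℝ) :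
    frame (cover q) w = mfderiv 𝓘(ℝ, ℝ × ℝ) cylModel cover q w := by
  have h : shift (cover q) = cover ∘ (fun w ↦ q + w) := funext (shift_cover q)
  have h1 : HasMFDerivAt 𝓘(ℝ, ℝ × ℝ) 𝓘(ℝ, ℝ × ℝ) (fun w : ℝ × ℝ ↦ q + w) 0
      (ContinuousLinearMap.id ℝ (ℝ × ℝ)) :=
    ((hasFDerivAt_id (𝕜 := ℝ) (0 : ℝ × ℝ)).const_add q).hasMFDerivAt
  have h2 : HasMFDerivAt 𝓘(ℝ, ℝ × ℝ) cylModel cover (q + 0)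
      (mfderiv 𝓘(ℝ, ℝ × ℝ) cylModel cover (q + 0)) :=
    (contMDiff_cover.mdifferentiableAt (by simp)).hasMFDerivAt
  have h3 := (h2.comp 0 h1).mfderiv
  rw [← h] at h3
  have h4 : frame (cover q) w = mfderiv 𝓘(ℝ, ℝ × ℝ) cylModel cover (q + 0) w :=
    congrArg (fun f : (ℝ × ℝ) →L[ℝ] (ℝ × EuclideanSpace ℝ (Fin 1)) ↦ f w) h3
  rw [h4, add_zero]

theorem coframe_frame (x : ℝ × Circle) (w : ℝ × ℝ) : coframe x (frame x w) = w := by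
  obtain ⟨q, rfl⟩ := cover_surjective x
  rw [frame_cover, coframe_mfderiv_cover]

theorem contMDiff_frame {X : ℝ → ℝ × ℝ} (hX : ContDiff ℝ ∞ X) :
    ContMDiff cylModel cylModel.tangent ∞
      (fun x : ℝ × Circle ↦ (⟨x, frame x (X x.1)⟩ : TangentBundle cylModel (ℝ × Circle))) := by
  intro x₀
  have h := (contMDiff_shift.contMDiffAt (x := (x₀, (0 : ℝ × ℝ)))).mfderiv (m := ∞) shift
    (fun _ ↦ 0) contMDiffAt_const le_rfl
  have hv : ContMDiffAt cylModel 𝓘(ℝ, ℝ × ℝ).tangent ∞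
      (fun x : ℝ × Circle ↦ (⟨0, X x.1⟩ : TangentBundle 𝓘(ℝ, ℝ × ℝ) (ℝ × ℝ))) x₀ := by
    rw [contMDiffAt_totalSpace]
    refine ⟨contMDiffAt_const, ?_⟩
    simpa [Function.comp_def] using (hX.contMDiff.comp contMDiff_fst).contMDiffAt
  have hb : ContMDiffAt cylModel cylModel ∞ (fun x : ℝ × Circle ↦ shift x 0) x₀ := by
    simp only [shift_zero]
    exact contMDiffAt_id
  have := ContMDiffAt.clm_apply_of_inCoordinates (F₁ := ℝ × ℝ)
    (F₂ := ℝ × EuclideanSpace ℝ (Fin 1)) (E₁ := TangentSpace 𝓘(ℝ, ℝ × ℝ) (M := ℝ × ℝ))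
    (E₂ := TangentSpace cylModel (M := ℝ × Circle)) (b₁ := fun _ : ℝ × Circle ↦ (0 : ℝ × ℝ))
    (b₂ := fun x ↦ shift x 0)
    (ϕ := fun x ↦ mfderiv 𝓘(ℝ, ℝ × ℝ) cylModel (shift x) 0) (v := fun x ↦ X x.1) h hv hb
  refine this.congr_of_eventuallyEq (.of_forall fun x ↦ ?_)
  change (⟨x, _⟩ : TotalSpace _ _) = ⟨shift x 0, _⟩
  congr 1
  · exact (shift_zero x).symm

/-- A bilinear form on the cylinder given in terms of the coframe `(dt, dψ)`. -/
noncomputable def coframeForm (B : ℝ → ℝ × ℝ →L[ℝ] ℝ × ℝ →L[ℝ] ℝ) (x : ℝ × Circle) :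
    TangentSpace cylModel x →L[ℝ] TangentSpace cylModel x →L[ℝ] ℝ :=
  (ContinuousLinearMap.precomp ℝ (coframe x)).comp ((B x.1).comp (coframe x))

theorem coframeForm_apply (B : ℝ → ℝ × ℝ →L[ℝ] ℝ × ℝ →L[ℝ] ℝ) (x : ℝ × Circle)
    (v w : TangentSpace cylModel x) :
    coframeForm B x v w = B x.1 (coframe x v) (coframe x w) := rfl

theorem contMDiff_coframeForm {B : ℝ → ℝ × ℝ →L[ℝ] ℝ × ℝ →L[ℝ] ℝ} (hB : ContDiff ℝ ∞ B) :
    ContMDiff cylModel (cylModel.prod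
      𝓘(ℝ, ℝ × EuclideanSpace ℝ (Fin 1) →L[ℝ] ℝ × EuclideanSpace ℝ (Fin 1) →L[ℝ] ℝ)) ∞
    (fun x ↦ TotalSpace.mk'
      (ℝ × EuclideanSpace ℝ (Fin 1) →L[ℝ] ℝ × EuclideanSpace ℝ (Fin 1) →L[ℝ] ℝ)
      (E := fun x : ℝ × Circle ↦
        TangentSpace cylModel x →L[ℝ] TangentSpace cylModel x →L[ℝ] ℝ) x (coframeForm B x)) := by
  intro x₀
  rw [contMDiffAt_hom_bundle]
  refine ⟨contMDiffAt_id, ?_⟩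
  have hθ := contMDiffAt_coframe x₀
  have hB' : ContMDiffAt cylModel 𝓘(ℝ, ℝ × ℝ →L[ℝ] ℝ × ℝ →L[ℝ] ℝ) ∞
      (fun x : ℝ × Circle ↦ B x.1) x₀ := (hB.contMDiff.comp contMDiff_fst).contMDiffAt
  have h := (hθ.clm_precomp (F₃ := ℝ)).clm_comp (hB'.clm_comp hθ)
  refine h.congr_of_eventuallyEq ?_
  have hx₀ := (trivializationAt (ℝ × EuclideanSpace ℝ (Fin 1))
    (TangentSpace cylModel : ℝ × Circle → Type) x₀).open_baseSet.mem_nhds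
      (mem_baseSet_trivializationAt _ _ x₀)
  filter_upwards [hx₀] with x hx
  refine ContinuousLinearMap.ext fun v ↦ ContinuousLinearMap.ext fun w ↦ ?_
  rw [inCoordinates_apply_eq₂ hx hx (by trivial)]
  simp [coframeForm_apply, Trivialization.symmL_apply _ hx]

theorem exists_basis_of_gram {V : Type*} [AddCommGroup V] [Module ℝ V] [TopologicalSpace V]
    [FiniteDimensional ℝ V] (hV : Module.finrank ℝ V = 2)
    (g : V →L[ℝ] V →L[ℝ] ℝ) {e₀ e₁ : V} (h₀ : g e₀ e₀ = -1) (h₁ : g e₁ e₁ = 1)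
    (h₀₁ : g e₀ e₁ = 0) (h₁₀ : g e₁ e₀ = 0) :
    ∃ (n : ℕ) (b : Module.Basis (Fin (n + 1)) ℝ V),
      ∀ i j, g (b i) (b j) = if i = j then (if i = 0 then -1 else 1) else 0 := by
  have hli : LinearIndependent ℝ ![e₀, e₁] := by
    rw [LinearIndependent.pair_iff]
    intro s t hst
    have h2 := congrArg (g e₀) hst
    have h3 := congrArg (g e₁) hst
    simp [h₀, h₀₁] at h2
    simp [h₁, h₁₀] at h3
    exact ⟨h2, h3⟩
  refine ⟨1, basisOfLinearIndependentOfCardEqFinrank hli (by simp [hV]), fun i j ↦ ?_⟩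
  fin_cases i <;> fin_cases j <;> simp [h₀, h₁, h₀₁, h₁₀]

/-- The spacetime structure on the cylinder with metric `B` and time orientation `X` in the
coordinates `(t, ψ)`, both independent of `ψ`. -/
noncomputable def ofCoordinates (B : ℝ → ℝ × ℝ →L[ℝ] ℝ × ℝ →L[ℝ] ℝ) (X : ℝ → ℝ × ℝ)
    (hB : ContDiff ℝ ∞ B) (hX : ContDiff ℝ ∞ X) (hsymm : ∀ t v w, B t v w = B t w v)
    (hsig : ∀ t, ∃ e₀ e₁, B t e₀ e₀ = -1 ∧ B t e₁ e₁ = 1 ∧ B t e₀ e₁ = 0)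
    (htime : ∀ t, B t (X t) (X t) < 0) : Spacetime cylModel (ℝ × Circle) where
  g := coframeForm B
  symm x v w := hsymm _ _ _
  signature x := by
    obtain ⟨e₀, e₁, h₀, h₁, h₀₁⟩ := hsig x.1
    have : FiniteDimensional ℝ (TangentSpace cylModel x) :=
      inferInstanceAs (FiniteDimensional ℝ (ℝ × EuclideanSpace ℝ (Fin 1)))
    have hdim : Module.finrank ℝ (TangentSpace cylModel x) = 2 := by
      change Module.finrank ℝ (ℝ × EuclideanSpace ℝ (Fin 1)) = 2
      simp
    refine exists_basis_of_gram hdim (coframeForm B x) (e₀ := frame x e₀) (e₁ := frame x e₁)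
      ?_ ?_ ?_ ?_ <;> simp only [coframeForm_apply, coframe_frame]
    exacts [h₀, h₁, h₀₁, (hsymm _ _ _).trans h₀₁]
  smooth_g := contMDiff_coframeForm hB
  T x := frame x (X x.1)
  smooth_T := contMDiff_frame hX
  timelike_T x := by simpa only [coframeForm_apply, coframe_frame] using htime x.1

theorem hasDerivWithinAt_fst_curve {γ : ℝ → ℝ × Circle} {s : Set ℝ} {r : ℝ}
    (hγ : MDifferentiableWithinAt 𝓘(ℝ, ℝ) cylModel γ s r) :
    HasDerivWithinAt (fun u ↦ (γ u).1)
      (coframe (γ r) (mfderivWithin 𝓘(ℝ, ℝ) cylModel γ s r (1 : ℝ))).1 s r := by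
  have h1 : HasMFDerivAt cylModel 𝓘(ℝ, ℝ × ℂ) emb (γ r)
      (mfderiv cylModel 𝓘(ℝ, ℝ × ℂ) emb (γ r)) :=
    (contMDiff_emb.mdifferentiableAt (by simp)).hasMFDerivAt
  have h2 := (h1.comp_hasMFDerivWithinAt r hγ.hasMFDerivWithinAt)
  have h3 : HasFDerivWithinAt (emb ∘ γ) _ s r := h2.hasFDerivWithinAt
  have h4 := (hasFDerivAt_fst (𝕜 := ℝ)).comp_hasFDerivWithinAt r h3
  have h5 := h4.hasDerivWithinAt
  refine h5.congr_deriv ?_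
  exact (congrArg Prod.fst (embCoord_apply (γ r) (mfderiv cylModel 𝓘(ℝ, ℝ × ℂ) emb (γ r)
    (mfderivWithin 𝓘(ℝ, ℝ) cylModel γ s r (1 : ℝ))))).symm

theorem mfderivWithin_cover_line (q w : ℝ × ℝ) {s : ℝ} (hs : s ∈ Icc (0 : ℝ) 1) :
    mfderivWithin 𝓘(ℝ, ℝ) cylModel (fun u : ℝ ↦ cover (q + u • w)) (Icc 0 1) s (1 : ℝ) =
      frame (cover (q + s • w)) w := by
  have h1 : HasMFDerivWithinAt 𝓘(ℝ, ℝ) 𝓘(ℝ, ℝ × ℝ) (fun u : ℝ ↦ q + u • w) (Icc 0 1) s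
      (ContinuousLinearMap.toSpanSingleton ℝ w) :=
    ((ContinuousLinearMap.toSpanSingleton ℝ w).hasFDerivWithinAt.const_add q).hasMFDerivWithinAt
  have h2 : HasMFDerivAt 𝓘(ℝ, ℝ × ℝ) cylModel cover (q + s • w)
      (mfderiv 𝓘(ℝ, ℝ × ℝ) cylModel cover (q + s • w)) :=
    (contMDiff_cover.mdifferentiableAt (by simp)).hasMFDerivAt
  have h3 := (h2.comp_hasMFDerivWithinAt s h1).mfderivWithin
    (uniqueMDiffOn_iff_uniqueDiffOn.2 (uniqueDiffOn_Icc zero_lt_one) s hs)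
  rw [frame_cover]
  refine (congrArg (fun f : ℝ →L[ℝ] (ℝ × EuclideanSpace ℝ (Fin 1)) ↦ f 1) h3).trans ?_
  change mfderiv 𝓘(ℝ, ℝ × ℝ) cylModel cover (q + s • w) ((1 : ℝ) • w) = _
  rw [one_smul]

theorem existsCurve_cover {P : (z : ℝ × Circle) → TangentSpace cylModel z → Prop} (q w : ℝ × ℝ)
    (hP : ∀ s : ℝ, P (cover (q + s • w)) (frame (cover (q + s • w)) w)) :
    ExistsCurve cylModel P (cover q) (cover (q + w)) := by
  refine ⟨fun u : ℝ ↦ cover (q + u • w), 1, fun i ↦ i, one_pos, by simp, by simp, fun i hi ↦ ?_⟩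
  obtain rfl : i = 0 := by omega
  simp only [Nat.cast_zero, zero_add, Nat.cast_one]
  refine ⟨zero_lt_one, ?_, fun s hs ↦ ?_⟩
  · have : ContDiff ℝ ∞ (fun u : ℝ ↦ q + u • w) := by fun_prop
    exact (contMDiff_cover.comp this.contMDiff).contMDiffOn
  · rw [mfderivWithin_cover_line q w hs]
    exact hP s

theorem cover_add_period (q : ℝ × ℝ) : cover (q + (0, 2 * Real.pi)) = cover q := by
  simp [cover]

theorem cover_sub_period (q : ℝ × ℝ) : cover (q + (0, -(2 * Real.pi))) = cover q := by
  rw [← cover_add_period (q + _)]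
  congr 1
  ext <;> simp

/-- If `dt` is positive on all vectors satisfying `P` at points where `t` is at least its value
at `x`, then no curve with velocities in `P` returns to `x`. -/
theorem not_existsCurve_self {P : (z : ℝ × Circle) → TangentSpace cylModel z → Prop}
    {x : ℝ × Circle} (hP : ∀ z v, x.1 ≤ z.1 → P z v → 0 < (coframe z v).1) :
    ¬ ExistsCurve cylModel P x x := by
  rintro ⟨γ, n, τ, hn, h0, hn', hγ⟩
  have key : ∀ i < n, x.1 ≤ (γ (τ i)).1 → (γ (τ i)).1 < (γ (τ (i + 1))).1 := by
    intro i hi hxi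
    obtain ⟨hlt, hsm, hv⟩ := hγ i hi
    have hd : ∀ s ∈ Icc (τ i) (τ (i + 1)), HasDerivWithinAt (fun u ↦ (γ u).1)
        (coframe (γ s) (mfderivWithin 𝓘(ℝ, ℝ) cylModel γ (Icc (τ i) (τ (i + 1))) s (1 : ℝ))).1
        (Icc (τ i) (τ (i + 1))) s := fun s hs ↦
      hasDerivWithinAt_fst_curve ((hsm s hs).mdifferentiableWithinAt (by simp))
    have hcont : ContinuousOn (fun u ↦ (γ u).1) (Icc (τ i) (τ (i + 1))) :=
      fun s hs ↦ (hd s hs).continuousWithinAt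
    have hge : ∀ s ∈ Icc (τ i) (τ (i + 1)), (γ (τ i)).1 ≤ (γ s).1 := by
      intro s hs
      have := image_le_of_deriv_right_lt_deriv_boundary (f := fun u ↦ -(γ u).1)
        (B := fun _ ↦ -(γ (τ i)).1) (B' := fun _ ↦ 0) hcont.neg
        (fun r hr ↦ ((hd r (Ico_subset_Icc_self hr)).neg.mono_of_mem_nhdsWithin
          (Icc_mem_nhdsGE_of_mem hr))) le_rfl
        (fun r ↦ hasDerivAt_const _ _) (fun r hr hr' ↦ by
          have hr'' : (γ r).1 = (γ (τ i)).1 := neg_injective hr'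
          have := hP _ _ (hr''.symm ▸ hxi) (hv r (Ico_subset_Icc_self hr))
          linarith) hs
      simpa using this
    have hmono : StrictMonoOn (fun u ↦ (γ u).1) (Icc (τ i) (τ (i + 1))) := by
      refine strictMonoOn_of_deriv_pos (convex_Icc _ _) hcont fun s hs ↦ ?_
      have hs' := interior_subset hs
      rw [((hd s hs').hasDerivAt (mem_interior_iff_mem_nhds.1 hs)).deriv]
      exact hP _ _ (hxi.trans (hge s hs')) (hv s hs')
    exact hmono (left_mem_Icc.2 hlt.le) (right_mem_Icc.2 hlt.le) hlt
  have hle : ∀ i ≤ n, x.1 ≤ (γ (τ i)).1 ∧ (0 < i → x.1 < (γ (τ i)).1) := by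
    intro i
    induction i with
    | zero => intro _; simp [h0]
    | succ i ih =>
      intro hi
      have h1 := (ih (by omega)).1
      have h2 := h1.trans_lt (key i (by omega) h1)
      exact ⟨h2.le, fun _ ↦ h2⟩
  have := (hle n le_rfl).2 hn
  rw [hn'] at this
  exact lt_irrefl _ this

/-- The form `a (dt dψ + dψ dt) + h dψ²` on the plane. -/
noncomputable def planeForm (a h : ℝ) : ℝ × ℝ →L[ℝ] ℝ × ℝ →L[ℝ] ℝ :=
  (ContinuousLinearMap.fst ℝ ℝ ℝ).smulRight (a • ContinuousLinearMap.snd ℝ ℝ ℝ) +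
    ContinuousLinearMap.smulRightL ℝ (ℝ × ℝ) (ℝ × ℝ →L[ℝ] ℝ) (ContinuousLinearMap.snd ℝ ℝ ℝ)
      (a • ContinuousLinearMap.fst ℝ ℝ ℝ + h • ContinuousLinearMap.snd ℝ ℝ ℝ)

theorem contDiff_planeForm (a : ℝ) : ContDiff ℝ ∞ (planeForm a) :=
  contDiff_const.add ((ContinuousLinearMap.contDiff _).comp
    (contDiff_const.add (contDiff_id.smul contDiff_const)))

theorem planeForm_apply (a h : ℝ) (v w : ℝ × ℝ) :
    planeForm a h v w = a * (v.1 * w.2 + v.2 * w.1) + h * (v.2 * w.2) := by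
  have : planeForm a h v w = v.1 * (a * w.2) + v.2 * (a * w.1 + h * w.2) := rfl
  rw [this]
  ring

/-- The flat cylinder: in the coordinates `t = x⁰ - x¹`, `ψ = x⁰ + x¹` the metric is `-dt dψ`. -/
noncomputable def flatNullCylinder : Spacetime cylModel (ℝ × Circle) :=
  ofCoordinates (fun _ ↦ planeForm (-1 / 2) 0) (fun _ ↦ (1, 1)) contDiff_const contDiff_const
    (fun _ v w ↦ by simp only [planeForm_apply]; ring)
    (fun _ ↦ ⟨(1, 1), (1, -1), by norm_num [planeForm_apply], by norm_num [planeForm_apply],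
      by norm_num [planeForm_apply]⟩)
    (fun _ ↦ by norm_num [planeForm_apply])

/-- Misner spacetime. -/
noncomputable def misner : Spacetime cylModel (ℝ × Circle) :=
  ofCoordinates (fun t ↦ planeForm 1 t) (fun t ↦ (1 + t / 2, -1))
    (contDiff_planeForm 1) (by fun_prop)
    (fun _ v w ↦ by simp only [planeForm_apply]; ring)
    (fun t ↦ by
      have h2 : (√2)⁻¹ * (√2)⁻¹ = (1 / 2 : ℝ) := by
        rw [← mul_inv, Real.mul_self_sqrt zero_le_two, one_div]
      refine ⟨(√2)⁻¹ • (1 + t / 2, -1), (√2)⁻¹ • (1 - t / 2, 1), ?_, ?_, ?_⟩ <;>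
        simp only [map_smul, smul_apply, smul_eq_mul, planeForm_apply]
      exacts [by linear_combination -2 * h2, by linear_combination 2 * h2, by ring])
    (fun t ↦ by simp only [planeForm_apply]; linarith)

theorem flatNullCylinder_g (x : ℝ × Circle) (v w : TangentSpace cylModel x) :
    flatNullCylinder.g x v w = -1 / 2 * ((coframe x v).1 * (coframe x w).2 +
      (coframe x v).2 * (coframe x w).1) := by
  have : flatNullCylinder.g x v w = planeForm (-1 / 2) 0 (coframe x v) (coframe x w) := rfl
  rw [this, planeForm_apply]
  ring

theorem misner_g (x : ℝ × Circle) (v w : TangentSpace cylModel x) :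
    misner.g x v w = (coframe x v).1 * (coframe x w).2 + (coframe x v).2 * (coframe x w).1 +
      x.1 * ((coframe x v).2 * (coframe x w).2) := by
  have : misner.g x v w = planeForm 1 x.1 (coframe x v) (coframe x w) := rfl
  rw [this, planeForm_apply, one_mul]

theorem coframe_flatNullCylinder_T (x : ℝ × Circle) :
    coframe x (flatNullCylinder.T x) = (1, 1) := coframe_frame x (1, 1)

theorem coframe_misner_T (x : ℝ × Circle) :
    coframe x (misner.T x) = (1 + x.1 / 2, -1) := coframe_frame x (1 + x.1 / 2, -1)

/-- The null coordinates `(x⁰ - x¹, x⁰ + x¹)` of the Minkowski plane. -/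
noncomputable def nullCoord : ℝ × ℝ →L[ℝ] ℝ × ℝ :=
  (ContinuousLinearMap.fst ℝ ℝ ℝ - ContinuousLinearMap.snd ℝ ℝ ℝ).prod
    (ContinuousLinearMap.fst ℝ ℝ ℝ + ContinuousLinearMap.snd ℝ ℝ ℝ)

theorem mfderiv_cover_nullCoord (q v : ℝ × ℝ) :
    mfderiv 𝓘(ℝ, ℝ × ℝ) cylModel (cover ∘ nullCoord) q v =
      frame (cover (nullCoord q)) (nullCoord v) := by
  have h1 : HasMFDerivAt 𝓘(ℝ, ℝ × ℝ) 𝓘(ℝ, ℝ × ℝ) nullCoord q nullCoord :=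
    nullCoord.hasFDerivAt.hasMFDerivAt
  have h2 : HasMFDerivAt 𝓘(ℝ, ℝ × ℝ) cylModel cover (nullCoord q)
      (mfderiv 𝓘(ℝ, ℝ × ℝ) cylModel cover (nullCoord q)) :=
    (contMDiff_cover.mdifferentiableAt (by simp)).hasMFDerivAt
  rw [frame_cover]
  exact congrArg (fun f : (ℝ × ℝ) →L[ℝ] (ℝ × EuclideanSpace ℝ (Fin 1)) ↦ f v) (h2.comp q h1).mfderiv

theorem isFlatNullCylinder_flatNullCylinder : flatNullCylinder.IsFlatNullCylinder := by
  change PullsBackTo _ (cover ∘ nullCoord) _ _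
  refine fun q ↦ ⟨fun v w ↦ ?_, ?_⟩
  · rw [mfderiv_cover_nullCoord, mfderiv_cover_nullCoord]
    refine (flatNullCylinder_g (cover (nullCoord q)) _ _).trans ?_
    rw [coframe_frame, coframe_frame]
    simp only [nullCoord, ContinuousLinearMap.prod_apply, sub_apply, add_apply,
      ContinuousLinearMap.coe_fst', ContinuousLinearMap.coe_snd']
    ring
  · rw [mfderiv_cover_nullCoord]
    have : nullCoord (1, 0) = (1, 1) := by simp [nullCoord]
    rw [this]
    rfl

theorem isMisner_misner : misner.IsMisner := by
  change PullsBackTo _ cover _ _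
  refine fun q ↦ ⟨fun v w ↦ ?_, frame_cover _ _⟩
  rw [misner_g, coframe_mfderiv_cover, coframe_mfderiv_cover]
  rfl

theorem isChronological_flatNullCylinder : flatNullCylinder.IsChronological := by
  refine fun x ↦ not_existsCurve_self fun z v _ ⟨ht, hf⟩ ↦ ?_
  rw [IsTimelike, flatNullCylinder_g] at ht
  rw [IsFutureDirected, flatNullCylinder_g, coframe_flatNullCylinder_T] at hf
  by_contra h
  nlinarith

theorem lightlikeTo_self_flatNullCylinder (x : ℝ × Circle) : flatNullCylinder.LightlikeTo x x := by
  obtain ⟨q, rfl⟩ := cover_surjective x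
  have h := existsCurve_cover (P := fun z v ↦ flatNullCylinder.IsLightlike z v ∧
    flatNullCylinder.IsFutureDirected z v) q (0, 2 * Real.pi) fun s ↦ by
      generalize cover (q + s • (0, 2 * Real.pi)) = z
      refine ⟨⟨fun h0 ↦ ?_, ?_⟩, ?_⟩
      · have := congrArg (fun v ↦ (coframe z v).2) h0
        simp only [coframe_frame, map_zero, Prod.snd_zero] at this
        exact Real.two_pi_pos.ne' this
      · rw [flatNullCylinder_g, coframe_frame]
        simp
      · rw [IsFutureDirected, flatNullCylinder_g, coframe_frame, coframe_flatNullCylinder_T]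
        have := Real.two_pi_pos
        simp only
        linarith
  rwa [cover_add_period] at h

section General

variable {E : Type*} [NormedAddCommGroup E] [NormedSpace ℝ E] [FiniteDimensional ℝ E]
    {H : Type*} [TopologicalSpace H] {I : ModelWithCorners ℝ E H}
    {M : Type*} [TopologicalSpace M] [ChartedSpace H M] [IsManifold I ∞ M]
    [BoundarylessManifold I M] [T2Space M] [SecondCountableTopology M] [ConnectedSpace M]

theorem LightlikeTo.after {S : Spacetime I M} {x y : M} (h : S.LightlikeTo x y) : S.After x y := by
  obtain ⟨γ, n, τ, hn, hx, hy, hγ⟩ := h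
  exact ⟨γ, n, τ, hn, hx, hy, fun i hi ↦ ⟨(hγ i hi).1, (hγ i hi).2.1, fun s hs ↦
    ⟨.inr ((hγ i hi).2.2 s hs).1, ((hγ i hi).2.2 s hs).2⟩⟩⟩

end General

theorem not_isCNTV_flatNullCylinder : ¬ flatNullCylinder.IsCNTV :=
  fun ⟨x, hx⟩ ↦ hx (lightlikeTo_self_flatNullCylinder x).after

theorem isCNTV_misner : misner.IsCNTV := by
  refine ⟨(1, 1), not_existsCurve_self fun z v hz ⟨hc, hf⟩ ↦ ?_⟩
  replace hc : misner.g z v v ≤ 0 := hc.elim le_of_lt fun h ↦ h.2.le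
  rw [misner_g] at hc
  rw [IsFutureDirected, misner_g, coframe_misner_T] at hf
  change 1 ≤ z.1 at hz
  generalize coframe z v = u at hc hf
  obtain ⟨a, b⟩ := u
  simp only at hc hf ⊢
  have h1 : b * (2 * a + z.1 * b) ≤ 0 := by linarith
  have h2 : b < (2 * a + z.1 * b) / 2 := by linarith
  have hb : b ≤ 0 := by
    by_contra hb
    nlinarith
  rcases hb.eq_or_lt with rfl | hb
  · linarith
  · have h3 : 0 ≤ 2 * a + z.1 * b := by
      by_contra h3
      nlinarith
    nlinarith

theorem not_isChronological_misner : ¬ misner.IsChronological := by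
  intro hchron
  refine hchron (cover (-1, 0)) ?_
  have h := existsCurve_cover (P := fun z v ↦ misner.IsTimelike z v ∧
    misner.IsFutureDirected z v) (-1, 0) (0, -(2 * Real.pi)) fun s ↦ by
      have hz : (cover ((-1, 0) + s • (0, -(2 * Real.pi)))).1 = -1 := by simp [cover]
      generalize cover ((-1, 0) + s • (0, -(2 * Real.pi))) = z at hz
      have := Real.two_pi_pos
      constructor
      · rw [IsTimelike, misner_g, coframe_frame, hz]
        simp only
        nlinarith
      · rw [IsFutureDirected, misner_g, coframe_frame, coframe_misner_T, hz]
        simp only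
        linarith
  rwa [cover_sub_period] at h

end Spacetime

theorem mainTheorem8 :
    (∃ S : Spacetime Spacetime.cylModel (ℝ × Circle), S.IsFlatNullCylinder ∧
      S.IsChronological ∧ ¬ S.IsCNTV ∧ ∀ x : ℝ × Circle, S.LightlikeTo x x) ∧
    (∃ S : Spacetime Spacetime.cylModel (ℝ × Circle), S.IsMisner ∧
      S.IsCNTV ∧ ¬ S.IsChronological) := by
  exact ⟨⟨Spacetime.flatNullCylinder, Spacetime.isFlatNullCylinder_flatNullCylinder,
      Spacetime.isChronological_flatNullCylinder, Spacetime.not_isCNTV_flatNullCylinder,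
      Spacetime.lightlikeTo_self_flatNullCylinder⟩,
    Spacetime.misner, Spacetime.isMisner_misner, Spacetime.isCNTV_misner,
    Spacetime.not_isChronological_misner⟩
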